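/- Let $d\ge 0$ and $M\ge 2$ be fixed integers, $t\in\mathbb{R}$, and let $s:\mathbb{R}^d\times\mathbb{R}^d\to\mathbb{R}$ be a measurable symmetric function. For identities $i=1,2,\dots$ and instances $k=1,\dots,M$ let $X_{(i,k)}$ be random vectors in $\mathbb{R}^d$ on a common probability space, all with the same law $Q$, such that the families $(X_{(i,1)},\dots,X_{(i,M)})$, $i\ge 1$, are independent and identically distributed (embeddings of the same identity may be dependent). Put $Y_{(i,k),(i,l)}=\mathbb{1}\{s(X_{(i,k)},X_{(i,l)})\ge t\}$ for $k\neq l$ and $Y_{(i,k),(j,l)}=\mathbb{1}\{s(X_{(i,k)},X_{(j,l)})<t\}$ for $i\ne j$, and suppose that $Y_{(i,k),(i,l)}\sim\mathrm{Bernoulli}(\mathrm{FRR})$ for all $i$ and all $k\neq l$, and $Y_{(i,k),(j,l)}\sim\mathrm{Bernoulli}(\mathrm{FAR})$ for all $i\ne j$ and all $k,l$. Let $$\bar Y_{ii}=\frac{1}{M(M-1)}\sum_{k=1}^M\sum_{l\ne k}Y_{(i,k),(i,l)},\qquad \bar Y_{ij}=\frac1{M^2}\sum_{k,l=1}^M Y_{(i,k),(j,l)}\quad(i\neq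 j),$$ $$\widehat{\mathrm{FRR}}=\frac1G\sum_{i=1}^G\bar Y_{ii},\qquad \widehat{\mathrm{FAR}}=\frac1{G(G-1)}\sum_{i=1}^G\sum_{\substack{j=1\\ j\ne i}}^G\bar Y_{ij}.$$ Assume that $\lim_{G\to\infty}\mathrm{Var}(\sqrt G\,\widehat{\mathrm{FRR}})=c_{\mathrm{FRR}}$ and $\lim_{G\to\infty}\mathrm{Var}(\sqrt G\,\widehat{\mathrm{FAR}})=c_{\mathrm{FAR}}$ for some positive constants $c_{\mathrm{FRR}},c_{\mathrm{FAR}}$. Then, as $G\to\infty$ with $M$ fixed, $$\sqrt G(\widehat{\mathrm{FRR}}-\mathrm{FRR})\xrightarrow{d}\mathcal N\bigl(0,\mathrm{Var}(\bar Y_{11})\bigr)\quad\text{and}\quad \sqrt G(\widehat{\mathrm{FAR}}-\mathrm{FAR})\xrightarrow{d}\mathcal N\bigl(0,4\,\mathrm{Cov}(\bar Y_{12},\bar Y_{13})\bigr).$$ -/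

import Mathlib

open MeasureTheory ProbabilityTheory Filter
open scoped NNReal

noncomputable section

namespace FaceVerification

variable {Ω : Type*} {d M : ℕ}

/-- The error indicator of the comparison of instance `k` of identity `i` with instance `l` of
identity `j`: for `i = j` it is `1` exactly if `s ≥ t` (false rejection), for `i ≠ j` it is `1`
exactly if `s < t` (false acceptance). -/
def Y (s : EuclideanSpace ℝ (Fin d) → EuclideanSpace ℝ (Fin d) → ℝ) (t : ℝ)
    (X : ℕ → Fin M → Ω → EuclideanSpace ℝ (Fin d))
    (i : ℕ) (k : Fin M) (j : ℕ) (l : Fin M) (ω : Ω) : ℝ :=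
  open Classical in
  if i = j then (if t ≤ s (X i k ω) (X j l ω) then 1 else 0)
  else (if s (X i k ω) (X j l ω) < t then 1 else 0)

/-- The identity-level averages: over ordered pairs of distinct instances when `i = j`, over all
pairs of instances when `i ≠ j`. -/
def Ybar (s : EuclideanSpace ℝ (Fin d) → EuclideanSpace ℝ (Fin d) → ℝ) (t : ℝ)
    (X : ℕ → Fin M → Ω → EuclideanSpace ℝ (Fin d)) (i j : ℕ) (ω : Ω) : ℝ :=
  if i = j then
    ∑ k : Fin M, ∑ l ∈ Finset.univ.filter (fun l : Fin M => l ≠ k),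
      Y s t X i k i l ω / ((M : ℝ) * ((M : ℝ) - 1))
  else
    ∑ k : Fin M, ∑ l : Fin M, Y s t X i k j l ω / (M : ℝ) ^ 2

/-- The estimator of the false rejection rate from the first `G` identities. -/
def FRRhat (s : EuclideanSpace ℝ (Fin d) → EuclideanSpace ℝ (Fin d) → ℝ) (t : ℝ)
    (X : ℕ → Fin M → Ω → EuclideanSpace ℝ (Fin d)) (G : ℕ) (ω : Ω) : ℝ :=
  ∑ i ∈ Finset.range G, Ybar s t X i i ω / (G : ℝ)

/-- The estimator of the false acceptance rate from the first `G` identities. -/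
def FARhat (s : EuclideanSpace ℝ (Fin d) → EuclideanSpace ℝ (Fin d) → ℝ) (t : ℝ)
    (X : ℕ → Fin M → Ω → EuclideanSpace ℝ (Fin d)) (G : ℕ) (ω : Ω) : ℝ :=
  ∑ i ∈ Finset.range G, ∑ j ∈ (Finset.range G).filter (fun j => j ≠ i),
    Ybar s t X i j ω / ((G : ℝ) * ((G : ℝ) - 1))

end FaceVerification

end

/-!
`FRRhat` is an average of independent and identically distributed variables, one per identity, so
the classical central limit theorem applies. `FARhat` is a U-statistic of order two in the
independent embedding families: its kernel `h` splits (Hoeffding) as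
`h x y = g x + g y - m + r x y`, where `g` is the average of `h` over one argument, `m` is the mean
and `r` averages to zero in each argument. The `g`-part is again an average of independent
variables, with asymptotic variance `4 Var g`, and `Var g` is the covariance of two kernel values
sharing one identity. Distinct pairs of identities give uncorrelated values of `r`, so the `r`-part
has second moment of order `1 / G ^ 2` and vanishes after multiplication by `√G`.
-/

namespace UStatistic

section Kernel

variable {E : Type*} [MeasurableSpace E]

/-- The Hájek projection of a kernel `h`, i.e. its average over the second argument: the
conditional expectation of `h X Y` given `X` when `X` and `Y` are independent and `Y` has
law `μ`. -/
noncomputable def hajekProj (μ : Measure E) (h : E → E → ℝ) (x : E) : ℝ := ∫ y, h x y ∂μ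

/-- The second-order term of the Hoeffding decomposition of a symmetric kernel: what remains of
`h x y` after removing the mean and the centred Hájek projections at `x` and at `y`. The constant
is added because the mean is subtracted twice with the projections. -/
noncomputable def hoeffdingRemainder (μ : Measure E) (h : E → E → ℝ) (x y : E) : ℝ :=
  h x y - hajekProj μ h x - hajekProj μ h y + ∫ z, hajekProj μ h z ∂μ

/-- A kernel is degenerate if its Hájek projection vanishes almost everywhere. -/
def IsDegenerate (μ : Measure E) (h : E → E → ℝ) : Prop := hajekProj μ h =ᵐ[μ] 0

variable {μ : Measure E} {h : E → E → ℝ}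

lemma hoeffdingRemainder_symm (hsymm : ∀ x y, h x y = h y x) (x y : E) :
    hoeffdingRemainder μ h x y = hoeffdingRemainder μ h y x := by
  simp only [hoeffdingRemainder, hsymm x y]
  ring

variable [IsProbabilityMeasure μ]

lemma integrable_mul_of_shared_fst (hh : MemLp (Function.uncurry h) 2 (μ.prod μ)) :
    Integrable (fun q : E × E × E => h q.1 q.2.1 * h q.1 q.2.2) (μ.prod (μ.prod μ)) :=
  (hh.comp_measurePreserving ((MeasurePreserving.id μ).prod measurePreserving_fst)).integrable_mul
    (hh.comp_measurePreserving ((MeasurePreserving.id μ).prod measurePreserving_snd))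

lemma memLp_hajekProj (hh : MemLp (Function.uncurry h) 2 (μ.prod μ)) :
    MemLp (hajekProj μ h) 2 μ := by
  have hmeas : AEStronglyMeasurable (hajekProj μ h) μ := hh.1.integral_prod_right'
  -- the square of the projection is the marginal of the integrable function `h x y * h x z`
  refine (memLp_two_iff_integrable_sq hmeas).2
    ((integrable_mul_of_shared_fst hh).integral_prod_left.congr (.of_forall fun x => ?_))
  simp only [hajekProj, integral_prod_mul, sq]

lemma memLp_hoeffdingRemainder (hh : MemLp (Function.uncurry h) 2 (μ.prod μ)) :
    MemLp (Function.uncurry (hoeffdingRemainder μ h)) 2 (μ.prod μ) :=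
  ((hh.sub ((memLp_hajekProj hh).comp_fst μ)).sub ((memLp_hajekProj hh).comp_snd μ)).add
    (memLp_const _)

lemma isDegenerate_hoeffdingRemainder (hh : MemLp (Function.uncurry h) 2 (μ.prod μ)) :
    IsDegenerate μ (hoeffdingRemainder μ h) := by
  have hproj : Integrable (hajekProj μ h) μ := (memLp_hajekProj hh).integrable one_le_two
  filter_upwards [(hh.integrable one_le_two).prod_right_ae] with x (hx : Integrable (h x) μ)
  have hx₁ : Integrable (fun y => h x y - hajekProj μ h x) μ := hx.sub (integrable_const _)
  have hx₂ : Integrable (fun y => h x y - hajekProj μ h x - hajekProj μ h y) μ := hx₁.sub hproj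
  change ∫ y, hoeffdingRemainder μ h x y ∂μ = 0
  simp only [hoeffdingRemainder]
  rw [integral_add hx₂ (integrable_const _), integral_sub hx₁ hproj,
    integral_sub hx (integrable_const _), ← hajekProj.eq_def μ h x]
  simp

end Kernel

section IID

variable {Ω E ι : Type*} [MeasurableSpace Ω] [MeasurableSpace E] {P : Measure Ω}
  [IsProbabilityMeasure P] {μ : Measure E} {Z : ι → Ω → E} {h : E → E → ℝ}

lemma hasLaw_pair (hindep : iIndepFun Z P) (hlaw : ∀ i, HasLaw (Z i) μ P) {i j : ι}
    (hij : i ≠ j) : HasLaw (fun ω => (Z i ω, Z j ω)) (μ.prod μ) P :=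
  (hindep.indepFun hij).hasLaw_prod (hlaw i) (hlaw j)

lemma hasLaw_triple (hindep : iIndepFun Z P) (hlaw : ∀ i, HasLaw (Z i) μ P) {i j k : ι}
    (hij : i ≠ j) (hik : i ≠ k) (hjk : j ≠ k) :
    HasLaw (fun ω => (Z i ω, Z j ω, Z k ω)) (μ.prod (μ.prod μ)) P :=
  (hindep.indepFun_prodMk₀ (fun l => (hlaw l).aemeasurable) j k i hij.symm
    hik.symm).symm.hasLaw_prod (hlaw i) (hasLaw_pair hindep hlaw hjk)

lemma memLp_kernel (hindep : iIndepFun Z P) (hlaw : ∀ i, HasLaw (Z i) μ P)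
    (hh : MemLp (Function.uncurry h) 2 (μ.prod μ)) {i j : ι} (hij : i ≠ j) :
    MemLp (fun ω => h (Z i ω) (Z j ω)) 2 P := by
  have hpair := hasLaw_pair hindep hlaw hij
  rw [← hpair.map_eq] at hh
  exact hh.comp_of_map hpair.aemeasurable

variable [IsProbabilityMeasure μ]

lemma integral_kernel (hindep : iIndepFun Z P) (hlaw : ∀ i, HasLaw (Z i) μ P)
    (hh : MemLp (Function.uncurry h) 2 (μ.prod μ)) {i j : ι} (hij : i ≠ j) :
    ∫ ω, h (Z i ω) (Z j ω) ∂P = ∫ x, hajekProj μ h x ∂μ :=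
  ((hasLaw_pair hindep hlaw hij).integral_comp hh.1).trans
    (integral_prod _ (hh.integrable one_le_two))

lemma integral_kernel_mul_kernel_of_shared (hindep : iIndepFun Z P)
    (hlaw : ∀ i, HasLaw (Z i) μ P) (hh : MemLp (Function.uncurry h) 2 (μ.prod μ)) {i j k : ι}
    (hij : i ≠ j) (hik : i ≠ k) (hjk : j ≠ k) :
    ∫ ω, h (Z i ω) (Z j ω) * h (Z i ω) (Z k ω) ∂P = ∫ x, hajekProj μ h x ^ 2 ∂μ := by
  have hint := integrable_mul_of_shared_fst hh
  calc ∫ ω, h (Z i ω) (Z j ω) * h (Z i ω) (Z k ω) ∂P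
      = ∫ q : E × E × E, h q.1 q.2.1 * h q.1 q.2.2 ∂μ.prod (μ.prod μ) :=
        (hasLaw_triple hindep hlaw hij hik hjk).integral_comp hint.1
    _ = ∫ x, ∫ q : E × E, h x q.1 * h x q.2 ∂μ.prod μ ∂μ := integral_prod _ hint
    _ = ∫ x, hajekProj μ h x ^ 2 ∂μ := by simp only [integral_prod_mul, hajekProj, sq]

lemma integral_kernel_mul_kernel_of_disjoint (hindep : iIndepFun Z P)
    (hlaw : ∀ i, HasLaw (Z i) μ P) (hh : MemLp (Function.uncurry h) 2 (μ.prod μ)) {i j k l : ι}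
    (hij : i ≠ j) (hik : i ≠ k) (hil : i ≠ l) (hjk : j ≠ k) (hjl : j ≠ l) (hkl : k ≠ l) :
    ∫ ω, h (Z i ω) (Z j ω) * h (Z k ω) (Z l ω) ∂P = (∫ x, hajekProj μ h x ∂μ) ^ 2 := by
  have hpair := hindep.indepFun_prodMk_prodMk₀ (fun m => (hlaw m).aemeasurable) i j k l
    hik hil hjk hjl
  have hmul := hpair.integral_comp_mul_comp (f := Function.uncurry h) (g := Function.uncurry h)
    (hasLaw_pair hindep hlaw hij).aemeasurable (hasLaw_pair hindep hlaw hkl).aemeasurable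
    (by rw [(hasLaw_pair hindep hlaw hij).map_eq]; exact hh.1)
    (by rw [(hasLaw_pair hindep hlaw hkl).map_eq]; exact hh.1)
  calc ∫ ω, h (Z i ω) (Z j ω) * h (Z k ω) (Z l ω) ∂P
      = (∫ ω, h (Z i ω) (Z j ω) ∂P) * ∫ ω, h (Z k ω) (Z l ω) ∂P := hmul
    _ = (∫ x, hajekProj μ h x ∂μ) ^ 2 := by
        rw [integral_kernel hindep hlaw hh hij, integral_kernel hindep hlaw hh hkl, sq]

lemma covariance_kernel_of_shared (hindep : iIndepFun Z P) (hlaw : ∀ i, HasLaw (Z i) μ P)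
    (hh : MemLp (Function.uncurry h) 2 (μ.prod μ)) {i j k : ι}
    (hij : i ≠ j) (hik : i ≠ k) (hjk : j ≠ k) :
    cov[fun ω => h (Z i ω) (Z j ω), fun ω => h (Z i ω) (Z k ω); P] = Var[hajekProj μ h; μ] := by
  rw [covariance_eq_sub (memLp_kernel hindep hlaw hh hij) (memLp_kernel hindep hlaw hh hik),
    variance_eq_sub (memLp_hajekProj hh)]
  simp only [Pi.mul_apply, Pi.pow_apply]
  rw [integral_kernel_mul_kernel_of_shared hindep hlaw hh hij hik hjk,
    integral_kernel hindep hlaw hh hij, integral_kernel hindep hlaw hh hik, sq (∫ x, _ ∂μ)]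

lemma integral_kernel_mul_kernel_eq_zero (hindep : iIndepFun Z P)
    (hlaw : ∀ i, HasLaw (Z i) μ P) (hh : MemLp (Function.uncurry h) 2 (μ.prod μ))
    (hsymm : ∀ x y, h x y = h y x) (hdeg : IsDegenerate μ h) {p q : ι × ι}
    (hp : p.1 ≠ p.2) (hq : q.1 ≠ q.2) (hqp : q ≠ p) (hqp' : q ≠ p.swap) :
    ∫ ω, h (Z p.1 ω) (Z p.2 ω) * h (Z q.1 ω) (Z q.2 ω) ∂P = 0 := by
  have shared {i j k : ι} (hij : i ≠ j) (hik : i ≠ k) (hjk : j ≠ k) :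
      ∫ ω, h (Z i ω) (Z j ω) * h (Z i ω) (Z k ω) ∂P = 0 := by
    rw [integral_kernel_mul_kernel_of_shared hindep hlaw hh hij hik hjk]
    exact integral_eq_zero_of_ae (hdeg.mono fun x hx => by simp [hx])
  obtain ⟨i, j⟩ := p
  obtain ⟨k, l⟩ := q
  simp only [ne_eq, Prod.mk.injEq, Prod.swap_prod_mk, not_and] at hp hq hqp hqp' ⊢
  by_cases hik : i = k
  · subst hik
    exact shared hp hq fun hjl => hqp rfl hjl.symm
  by_cases hil : i = l
  · subst hil
    simp_rw [hsymm (Z k _) (Z i _)]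
    exact shared hp hik fun hjk => hqp' hjk.symm rfl
  by_cases hjk : j = k
  · subst hjk
    simp_rw [hsymm (Z i _) (Z j _)]
    exact shared (Ne.symm hp) hq hil
  by_cases hjl : j = l
  · subst hjl
    simp_rw [hsymm (Z i _) (Z j _), hsymm (Z k _) (Z j _)]
    exact shared (Ne.symm hp) hjk hik
  · rw [integral_kernel_mul_kernel_of_disjoint hindep hlaw hh hp hik hil hjk hjl hq,
      integral_eq_zero_of_ae hdeg, sq, zero_mul]

lemma integral_sq_sum_offDiag_of_isDegenerate (hindep : iIndepFun Z P)
    (hlaw : ∀ i, HasLaw (Z i) μ P) (hh : MemLp (Function.uncurry h) 2 (μ.prod μ))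
    (hsymm : ∀ x y, h x y = h y x) (hdeg : IsDegenerate μ h) (s : Finset ι) :
    ∫ ω, (∑ p ∈ s.offDiag, h (Z p.1 ω) (Z p.2 ω)) ^ 2 ∂P =
      s.offDiag.card * (2 * ∫ q : E × E, h q.1 q.2 ^ 2 ∂μ.prod μ) := by
  have hint : ∀ p ∈ s.offDiag, ∀ q ∈ s.offDiag,
      Integrable (fun ω => h (Z p.1 ω) (Z p.2 ω) * h (Z q.1 ω) (Z q.2 ω)) P := fun p hp q hq =>
    (memLp_kernel hindep hlaw hh (Finset.mem_offDiag.1 hp).2.2).integrable_mul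
      (memLp_kernel hindep hlaw hh (Finset.mem_offDiag.1 hq).2.2)
  have hsq {i j : ι} (hij : i ≠ j) : ∫ ω, h (Z i ω) (Z j ω) * h (Z i ω) (Z j ω) ∂P =
      ∫ q : E × E, h q.1 q.2 ^ 2 ∂μ.prod μ := by
    simp only [← sq]
    exact (hasLaw_pair hindep hlaw hij).integral_comp (hh.1.pow 2)
  -- only the two orderings of the pair `p` itself correlate with `p`
  have hrow : ∀ p ∈ s.offDiag,
      ∑ q ∈ s.offDiag, ∫ ω, h (Z p.1 ω) (Z p.2 ω) * h (Z q.1 ω) (Z q.2 ω) ∂P =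
        2 * ∫ q : E × E, h q.1 q.2 ^ 2 ∂μ.prod μ := by
    intro p hp
    obtain ⟨hp₁, hp₂, hne⟩ := Finset.mem_offDiag.1 hp
    have hswap : p.swap ∈ s.offDiag := Finset.mem_offDiag.2 ⟨hp₂, hp₁, hne.symm⟩
    have hpswap : p ≠ p.swap := fun heq => hne (congrArg Prod.fst heq)
    rw [Finset.sum_eq_add_of_mem p p.swap hp hswap hpswap fun q hq hqp =>
      integral_kernel_mul_kernel_eq_zero hindep hlaw hh hsymm hdeg hne
        (Finset.mem_offDiag.1 hq).2.2 hqp.1 hqp.2]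
    simp only [Prod.fst_swap, Prod.snd_swap, hsymm (Z p.2 _) (Z p.1 _), hsq hne]
    ring
  simp_rw [sq (Finset.sum _ _), Finset.sum_mul_sum]
  rw [integral_finsetSum _ fun p hp => integrable_finsetSum _ fun q hq => hint p hp q hq,
    Finset.sum_congr rfl fun p hp => integral_finsetSum _ fun q hq => hint p hp q hq,
    Finset.sum_congr rfl hrow, Finset.sum_const, nsmul_eq_mul]

end IID

section Algebra

lemma cast_card_offDiag {ι : Type*} (s : Finset ι) :
    (s.offDiag.card : ℝ) = s.card * (s.card - 1) := by
  rw [Finset.offDiag_card, Nat.cast_sub (Nat.le_mul_self _)]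
  push_cast
  ring

lemma sum_sum_filter_ne {ι : Type*} [DecidableEq ι] (s : Finset ι) (f : ι → ι → ℝ) :
    ∑ i ∈ s, ∑ j ∈ s.filter (fun j => j ≠ i), f i j = ∑ p ∈ s.offDiag, f p.1 p.2 := by
  rw [Finset.sum_sigma']
  exact Finset.sum_bij' (fun p _ => (p.1, p.2)) (fun p _ => ⟨p.1, p.2⟩)
    (by grind) (by grind) (by simp) (by simp) (by simp)

lemma sum_offDiag_fst_add_snd {ι : Type*} (s : Finset ι) (a : ι → ℝ) :
    ∑ p ∈ s.offDiag, (a p.1 + a p.2) = 2 * ((s.card : ℝ) - 1) * ∑ i ∈ s, a i := by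
  classical
  have hsplit := Finset.sum_union (f := fun p : ι × ι => a p.1 + a p.2)
    (Finset.disjoint_diag_offDiag s)
  rw [Finset.diag_union_offDiag, Finset.sum_product, Finset.sum_diag] at hsplit
  simp only [Finset.sum_add_distrib, Finset.sum_const, nsmul_eq_mul, ← Finset.mul_sum]
    at hsplit ⊢
  linarith

end Algebra

/-- The U-statistic of order two of the first `n` terms of a sequence: the average of the kernel
over ordered pairs of distinct indices. It is `0` for `n ≤ 1`. -/
noncomputable def uStatistic {E : Type*} (h : E → E → ℝ) (z : ℕ → E) (n : ℕ) : ℝ :=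
  (∑ p ∈ (Finset.range n).offDiag, h (z p.1) (z p.2)) / (n * ((n : ℝ) - 1))

lemma uStatistic_sub_mean_eq_average_add {E : Type*} [MeasurableSpace E] (μ : Measure E)
    (h : E → E → ℝ) (z : ℕ → E) {n : ℕ} (hn : 2 ≤ n) :
    uStatistic h z n - ∫ x, hajekProj μ h x ∂μ =
      ((∑ i ∈ Finset.range n, 2 * hajekProj μ h (z i)) / n - 2 * ∫ x, hajekProj μ h x ∂μ) +
        uStatistic (hoeffdingRemainder μ h) z n := by
  have hn' : (2 : ℝ) ≤ n := by exact_mod_cast hn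
  have hn₀ : (n : ℝ) ≠ 0 := by linarith
  have hn₁ : (n : ℝ) - 1 ≠ 0 := by linarith
  have hproj := sum_offDiag_fst_add_snd (Finset.range n) fun i => hajekProj μ h (z i)
  have hcard := cast_card_offDiag (Finset.range n)
  rw [Finset.card_range] at hproj hcard
  simp only [uStatistic, hoeffdingRemainder, sub_sub]
  rw [Finset.sum_add_distrib, Finset.sum_sub_distrib, hproj, Finset.sum_const, nsmul_eq_mul,
    hcard, ← Finset.mul_sum]
  field_simp
  ring

section Limit

variable {Ω E : Type*} [MeasurableSpace Ω] [MeasurableSpace E] {P : Measure Ω}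
  {μ : Measure E} {Z : ℕ → Ω → E} {h : E → E → ℝ}

lemma variance_comp_of_hasLaw {X : Ω → E} (hX : HasLaw X μ P) {f : E → ℝ}
    (hf : AEMeasurable f μ) : Var[fun ω => f (X ω); P] = Var[f; μ] := by
  rw [← hX.map_eq] at hf ⊢
  exact (variance_map hf hX.aemeasurable).symm

lemma tendstoInMeasure_zero_of_tendsto_integral_sq {f : ℕ → Ω → ℝ} (hf : ∀ n, MemLp (f n) 2 P)
    (hlim : Tendsto (fun n => ∫ ω, f n ω ^ 2 ∂P) atTop (nhds 0)) :
    TendstoInMeasure P f atTop 0 := by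
  refine tendstoInMeasure_of_tendsto_eLpNorm two_ne_zero (fun n => (hf n).1)
    aestronglyMeasurable_const ?_
  have hnorm (n : ℕ) : eLpNorm (f n - 0) 2 P = ENNReal.ofReal √(∫ ω, f n ω ^ 2 ∂P) := by
    rw [sub_zero, (hf n).eLpNorm_eq_integral_rpow_norm two_ne_zero ENNReal.ofNat_ne_top,
      Real.sqrt_eq_rpow]
    simp
  simp_rw [hnorm]
  simpa using ENNReal.tendsto_ofReal hlim.sqrt

variable [IsProbabilityMeasure P]

theorem tendstoInDistribution_sqrt_mul_average_sub {Ω' : Type*} [MeasurableSpace Ω']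
    {P' : Measure Ω'} [IsProbabilityMeasure P'] {f : E → ℝ} {Y : Ω' → ℝ}
    (hY : HasLaw Y (gaussianReal 0 Var[f; μ].toNNReal) P') (hindep : iIndepFun Z P)
    (hlaw : ∀ i, HasLaw (Z i) μ P) (hf : MemLp f 2 μ) :
    TendstoInDistribution
      (fun (n : ℕ) ω => √(n : ℝ) * ((∑ i ∈ Finset.range n, f (Z i ω)) / n - ∫ x, f x ∂μ))
      atTop Y (fun _ => P) P' := by
  have hf_map (i : ℕ) : MemLp f 2 (P.map (Z i)) := by rwa [(hlaw i).map_eq]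
  have hmean : ∫ ω, f (Z 0 ω) ∂P = ∫ x, f x ∂μ := (hlaw 0).integral_comp hf.1
  have hvar := variance_comp_of_hasLaw (hlaw 0) hf.aemeasurable
  refine (tendstoInDistribution_inv_sqrt_mul_sum_sub (X := fun i ω => f (Z i ω)) (by rwa [hvar])
    ((hf_map 0).comp_of_map (hlaw 0).aemeasurable)
    (hindep.comp₀ _ (fun i => (hlaw i).aemeasurable) fun i => (hf_map i).aemeasurable)
    fun i => ((hlaw i).identDistrib (hlaw 0)).comp_of_aemeasurable
      (hf_map i).aemeasurable).congr (fun n => .of_forall fun ω => ?_) .rfl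
  rcases n.eq_zero_or_pos with rfl | hn
  · simp
  · have hn₀ : (n : ℝ) ≠ 0 := by positivity
    simp only [hmean, ← Real.sqrt_div_self (x := n)]
    field_simp

lemma memLp_uStatistic (hindep : iIndepFun Z P) (hlaw : ∀ i, HasLaw (Z i) μ P)
    (hh : MemLp (Function.uncurry h) 2 (μ.prod μ)) (n : ℕ) :
    MemLp (fun ω => uStatistic h (Z · ω) n) 2 P := by
  simp only [uStatistic, div_eq_inv_mul]
  exact (memLp_finsetSum _ fun p hp =>
    memLp_kernel hindep hlaw hh (Finset.mem_offDiag.1 hp).2.2).const_mul _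

variable [IsProbabilityMeasure μ]

lemma integral_sq_uStatistic_of_isDegenerate (hindep : iIndepFun Z P)
    (hlaw : ∀ i, HasLaw (Z i) μ P) (hh : MemLp (Function.uncurry h) 2 (μ.prod μ))
    (hsymm : ∀ x y, h x y = h y x) (hdeg : IsDegenerate μ h) (n : ℕ) :
    ∫ ω, uStatistic h (Z · ω) n ^ 2 ∂P =
      2 * (∫ q : E × E, h q.1 q.2 ^ 2 ∂μ.prod μ) / (n * ((n : ℝ) - 1)) := by
  simp only [uStatistic, div_pow]
  rw [integral_div, integral_sq_sum_offDiag_of_isDegenerate hindep hlaw hh hsymm hdeg,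
    cast_card_offDiag, Finset.card_range]
  rcases eq_or_ne ((n : ℝ) * ((n : ℝ) - 1)) 0 with hzero | _
  · simp [hzero]
  · field_simp

lemma tendstoInMeasure_sqrt_mul_uStatistic_of_isDegenerate (hindep : iIndepFun Z P)
    (hlaw : ∀ i, HasLaw (Z i) μ P) (hh : MemLp (Function.uncurry h) 2 (μ.prod μ))
    (hsymm : ∀ x y, h x y = h y x) (hdeg : IsDegenerate μ h) :
    TendstoInMeasure P (fun (n : ℕ) ω => √(n : ℝ) * uStatistic h (Z · ω) n) atTop 0 := by
  refine tendstoInMeasure_zero_of_tendsto_integral_sq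
    (fun n => (memLp_uStatistic hindep hlaw hh n).const_mul _) ?_
  have hlim : Tendsto (fun n : ℕ => 2 * (∫ q : E × E, h q.1 q.2 ^ 2 ∂μ.prod μ) / ((n : ℝ) - 1))
      atTop (nhds 0) :=
    (tendsto_atTop_add_const_right _ _ tendsto_natCast_atTop_atTop).const_div_atTop _
  refine hlim.congr' ?_
  filter_upwards [eventually_ne_atTop 0] with n hn
  have hn₀ : (n : ℝ) ≠ 0 := Nat.cast_ne_zero.2 hn
  simp only [mul_pow, Real.sq_sqrt n.cast_nonneg]
  rw [integral_const_mul, integral_sq_uStatistic_of_isDegenerate hindep hlaw hh hsymm hdeg]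
  field_simp

theorem tendstoInDistribution_sqrt_mul_uStatistic_sub {Ω' : Type*} [MeasurableSpace Ω']
    {P' : Measure Ω'} [IsProbabilityMeasure P'] {Y : Ω' → ℝ}
    (hY : HasLaw Y (gaussianReal 0 (4 * Var[hajekProj μ h; μ]).toNNReal) P')
    (hindep : iIndepFun Z P) (hlaw : ∀ i, HasLaw (Z i) μ P)
    (hh : MemLp (Function.uncurry h) 2 (μ.prod μ)) (hsymm : ∀ x y, h x y = h y x) :
    TendstoInDistribution
      (fun (n : ℕ) ω => √(n : ℝ) * (uStatistic h (Z · ω) n - ∫ x, hajekProj μ h x ∂μ))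
      atTop Y (fun _ => P) P' := by
  have hvar : Var[fun x => 2 * hajekProj μ h x; μ] = 4 * Var[hajekProj μ h; μ] := by
    rw [variance_const_mul]
    norm_num
  have hclt := tendstoInDistribution_sqrt_mul_average_sub (by rwa [hvar]) hindep hlaw
    ((memLp_hajekProj hh).const_mul 2)
  rw [integral_const_mul] at hclt
  refine tendstoInDistribution_of_tendstoInMeasure_sub _ _ hclt ?_ fun n =>
    ((memLp_uStatistic hindep hlaw hh n).aemeasurable.sub_const _).const_mul _
  refine (tendstoInMeasure_sqrt_mul_uStatistic_of_isDegenerate hindep hlaw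
    (memLp_hoeffdingRemainder hh) (hoeffdingRemainder_symm hsymm)
    (isDegenerate_hoeffdingRemainder hh)).congr' ?_ .rfl
  filter_upwards [eventually_ge_atTop 2] with n hn
  refine .of_forall fun ω => ?_
  simp only [Pi.sub_apply, uStatistic_sub_mean_eq_average_add μ h (Z · ω) hn]
  ring

end Limit

end UStatistic

namespace FaceVerification

variable {d M : ℕ}

open Classical in
/-- The within-identity average `Ybar` as a function of the family of embeddings of one
identity. -/
noncomputable def withinKernel (s : EuclideanSpace ℝ (Fin d) → EuclideanSpace ℝ (Fin d) → ℝ)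
    (t : ℝ) (x : Fin M → EuclideanSpace ℝ (Fin d)) : ℝ :=
  ∑ k : Fin M, ∑ l ∈ Finset.univ.filter (fun l : Fin M => l ≠ k),
    (if t ≤ s (x k) (x l) then 1 else 0) / ((M : ℝ) * ((M : ℝ) - 1))

open Classical in
/-- The between-identity average `Ybar` as a function of the families of embeddings of two
identities. -/
noncomputable def betweenKernel (s : EuclideanSpace ℝ (Fin d) → EuclideanSpace ℝ (Fin d) → ℝ)
    (t : ℝ) (x y : Fin M → EuclideanSpace ℝ (Fin d)) : ℝ :=
  ∑ k : Fin M, ∑ l : Fin M, (if s (x k) (y l) < t then 1 else 0) / (M : ℝ) ^ 2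

variable {s : EuclideanSpace ℝ (Fin d) → EuclideanSpace ℝ (Fin d) → ℝ} {t : ℝ}

lemma betweenKernel_symm (hs : ∀ x y, s x y = s y x)
    (x y : Fin M → EuclideanSpace ℝ (Fin d)) :
    betweenKernel s t x y = betweenKernel s t y x := by
  unfold betweenKernel
  rw [Finset.sum_comm]
  simp_rw [hs (x _) (y _)]

lemma memLp_ite_one_zero {α : Type*} [MeasurableSpace α] {ν : Measure α} [IsFiniteMeasure ν]
    {p : α → Prop} [DecidablePred p] (hp : MeasurableSet {x | p x}) (q : ENNReal) :
    MemLp (fun x => if p x then (1 : ℝ) else 0) q ν :=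
  .of_bound (Measurable.ite hp measurable_const measurable_const).aestronglyMeasurable 1
    (.of_forall fun x => by split_ifs <;> simp)

lemma memLp_withinKernel (hs : Measurable (Function.uncurry s))
    (ν : Measure (Fin M → EuclideanSpace ℝ (Fin d))) [IsFiniteMeasure ν] (q : ENNReal) :
    MemLp (withinKernel s t) q ν := by
  unfold withinKernel
  simp only [div_eq_inv_mul]
  refine memLp_finsetSum _ fun k _ => memLp_finsetSum _ fun l _ =>
    (memLp_ite_one_zero (measurableSet_le measurable_const ?_) q).const_mul _
  exact hs.comp (f := fun x : Fin M → EuclideanSpace ℝ (Fin d) => (x k, x l)) (by fun_prop)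

lemma memLp_betweenKernel (hs : Measurable (Function.uncurry s))
    (ν : Measure ((Fin M → EuclideanSpace ℝ (Fin d)) × (Fin M → EuclideanSpace ℝ (Fin d))))
    [IsFiniteMeasure ν] (q : ENNReal) :
    MemLp (Function.uncurry (betweenKernel s t)) q ν := by
  simp only [Function.uncurry_def, betweenKernel, div_eq_inv_mul]
  refine memLp_finsetSum _ fun k _ => memLp_finsetSum _ fun l _ =>
    (memLp_ite_one_zero (measurableSet_lt ?_ measurable_const) q).const_mul _
  exact hs.comp (f := fun p : (Fin M → EuclideanSpace ℝ (Fin d)) × (Fin M → _) => (p.1 k, p.2 l))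
    (by fun_prop)

variable {Ω : Type*} {X : ℕ → Fin M → Ω → EuclideanSpace ℝ (Fin d)}

lemma Ybar_self (i : ℕ) (ω : Ω) : Ybar s t X i i ω = withinKernel s t (fun k => X i k ω) := by
  simp only [Ybar, withinKernel, Y, if_true]

lemma Ybar_of_ne {i j : ℕ} (hij : i ≠ j) (ω : Ω) :
    Ybar s t X i j ω = betweenKernel s t (fun k => X i k ω) (fun k => X j k ω) := by
  simp only [Ybar, betweenKernel, Y, if_neg hij]

lemma FRRhat_eq_average (G : ℕ) (ω : Ω) :
    FRRhat s t X G ω = (∑ i ∈ Finset.range G, withinKernel s t (fun k => X i k ω)) / G := by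
  simp only [FRRhat, Ybar_self, Finset.sum_div]

lemma FARhat_eq_uStatistic (G : ℕ) (ω : Ω) :
    FARhat s t X G ω = UStatistic.uStatistic (betweenKernel s t) (fun i k => X i k ω) G := by
  rw [FARhat, UStatistic.sum_sum_filter_ne, UStatistic.uStatistic, Finset.sum_div]
  refine Finset.sum_congr rfl fun p hp => ?_
  rw [Ybar_of_ne (Finset.mem_offDiag.1 hp).2.2]

lemma Y_eq_zero_or_one (i : ℕ) (k : Fin M) (j : ℕ) (l : Fin M) (ω : Ω) :
    Y s t X i k j l ω = 0 ∨ Y s t X i k j l ω = 1 := by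
  unfold Y
  split_ifs <;> simp

variable [MeasurableSpace Ω] {P : Measure Ω}

lemma aemeasurable_Y (hs : Measurable (Function.uncurry s)) (hX : ∀ i k, AEMeasurable (X i k) P)
    (i : ℕ) (k : Fin M) (j : ℕ) (l : Fin M) : AEMeasurable (Y s t X i k j l) P := by
  have hpair := (hX i k).prodMk (hX j l)
  unfold Y
  split_ifs
  · exact (Measurable.ite (measurableSet_le measurable_const hs) measurable_const
      measurable_const).comp_aemeasurable hpair
  · exact (Measurable.ite (measurableSet_lt hs measurable_const) measurable_const
      measurable_const).comp_aemeasurable hpair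

lemma integral_Y (hs : Measurable (Function.uncurry s)) (hX : ∀ i k, AEMeasurable (X i k) P)
    (i : ℕ) (k : Fin M) (j : ℕ) (l : Fin M) :
    ∫ ω, Y s t X i k j l ω ∂P = P.real {ω | Y s t X i k j l ω = 1} := by
  have hset : NullMeasurableSet {ω | Y s t X i k j l ω = 1} P :=
    (aemeasurable_Y hs hX i k j l).nullMeasurableSet_preimage (measurableSet_singleton 1)
  have hindicator :
      Y s t X i k j l = Set.indicator {ω | Y s t X i k j l ω = 1} (fun _ => (1 : ℝ)) := by
    ext ω
    rcases Y_eq_zero_or_one (s := s) (t := t) (X := X) i k j l ω with h | h <;> simp [h]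
  calc ∫ ω, Y s t X i k j l ω ∂P
      = ∫ ω, Set.indicator {ω | Y s t X i k j l ω = 1} (fun _ => (1 : ℝ)) ω ∂P := by
        rw [← hindicator]
    _ = P.real {ω | Y s t X i k j l ω = 1} := by
        rw [integral_indicator₀ hset, setIntegral_const, smul_eq_mul, mul_one]

section Mean

variable [IsFiniteMeasure P]

lemma integrable_Y (hs : Measurable (Function.uncurry s)) (hX : ∀ i k, AEMeasurable (X i k) P)
    (i : ℕ) (k : Fin M) (j : ℕ) (l : Fin M) : Integrable (Y s t X i k j l) P :=
  .of_bound (aemeasurable_Y hs hX i k j l).aestronglyMeasurable 1 (.of_forall fun ω => by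
    rcases Y_eq_zero_or_one (s := s) (t := t) (X := X) i k j l ω with h | h <;> simp [h])

lemma integral_Ybar_self (hM : 2 ≤ M) (hs : Measurable (Function.uncurry s))
    (hX : ∀ i k, AEMeasurable (X i k) P) {FRR : ℝ} (i : ℕ)
    (hFRR : ∀ k l : Fin M, k ≠ l → P.real {ω | Y s t X i k i l ω = 1} = FRR) :
    ∫ ω, Ybar s t X i i ω ∂P = FRR := by
  have hM' : (2 : ℝ) ≤ M := by exact_mod_cast hM
  have hM₀ : (M : ℝ) ≠ 0 := by linarith
  have hM₁ : (M : ℝ) - 1 ≠ 0 := by linarith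
  simp only [Ybar, if_true, UStatistic.sum_sum_filter_ne]
  have hterm : ∀ p ∈ (Finset.univ : Finset (Fin M)).offDiag,
      ∫ ω, Y s t X i p.1 i p.2 ω / ((M : ℝ) * ((M : ℝ) - 1)) ∂P =
        FRR / ((M : ℝ) * ((M : ℝ) - 1)) := fun p hp => by
    rw [integral_div, integral_Y hs hX, hFRR _ _ (Finset.mem_offDiag.1 hp).2.2]
  rw [integral_finsetSum _ fun p _ => (integrable_Y hs hX i p.1 i p.2).div_const _,
    Finset.sum_congr rfl hterm, Finset.sum_const, nsmul_eq_mul, UStatistic.cast_card_offDiag,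
    Finset.card_univ, Fintype.card_fin]
  field_simp

lemma integral_Ybar_of_ne (hM : M ≠ 0) (hs : Measurable (Function.uncurry s))
    (hX : ∀ i k, AEMeasurable (X i k) P) {FAR : ℝ} {i j : ℕ} (hij : i ≠ j)
    (hFAR : ∀ k l : Fin M, P.real {ω | Y s t X i k j l ω = 1} = FAR) :
    ∫ ω, Ybar s t X i j ω ∂P = FAR := by
  have hM₀ : (M : ℝ) ≠ 0 := Nat.cast_ne_zero.2 hM
  simp only [Ybar, if_neg hij, ← Finset.sum_div]
  rw [integral_div, integral_finsetSum _ fun k _ =>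
    integrable_finsetSum _ fun l _ => integrable_Y hs hX i k j l]
  simp_rw [integral_finsetSum _ fun l _ => integrable_Y hs hX i _ j l, integral_Y hs hX, hFAR]
  simp only [Finset.sum_const, Finset.card_univ, Fintype.card_fin, nsmul_eq_mul]
  field_simp

end Mean

variable {Ω' : Type*} [MeasurableSpace Ω'] {P' : Measure Ω'} [IsProbabilityMeasure P']
  [IsProbabilityMeasure P] {W : Ω' → ℝ} {μ : Measure (Fin M → EuclideanSpace ℝ (Fin d))}

theorem tendstoInDistribution_sqrt_mul_FRRhat_sub
    (hW : HasLaw W (gaussianReal 0 Var[Ybar s t X 0 0; P].toNNReal) P')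
    (hs : Measurable (Function.uncurry s)) (hindep : iIndepFun (fun i ω k => X i k ω) P)
    (hlaw : ∀ i, HasLaw (fun ω k => X i k ω) μ P) :
    TendstoInDistribution
      (fun (G : ℕ) ω => √(G : ℝ) * (FRRhat s t X G ω - P[Ybar s t X 0 0]))
      atTop W (fun _ => P) P' := by
  have : IsProbabilityMeasure μ := (hlaw 0).isProbabilityMeasure_iff.1 inferInstance
  have hkernel : MemLp (withinKernel s t) 2 μ := memLp_withinKernel hs μ 2
  have hmean : P[Ybar s t X 0 0] = ∫ x, withinKernel s t x ∂μ := by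
    simp only [Ybar_self]
    exact (hlaw 0).integral_comp hkernel.1
  have hvar : Var[Ybar s t X 0 0; P] = Var[withinKernel s t; μ] := by
    simp only [funext (Ybar_self 0)]
    exact UStatistic.variance_comp_of_hasLaw (hlaw 0) hkernel.aemeasurable
  rw [hvar] at hW
  simpa only [FRRhat_eq_average, hmean] using
    UStatistic.tendstoInDistribution_sqrt_mul_average_sub hW hindep hlaw hkernel

lemma covariance_Ybar_eq_variance_hajekProj [IsProbabilityMeasure μ]
    (hs : Measurable (Function.uncurry s)) (hindep : iIndepFun (fun i ω k => X i k ω) P)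
    (hlaw : ∀ i, HasLaw (fun ω k => X i k ω) μ P) {i j k : ℕ}
    (hij : i ≠ j) (hik : i ≠ k) (hjk : j ≠ k) :
    cov[Ybar s t X i j, Ybar s t X i k; P] =
      Var[UStatistic.hajekProj μ (betweenKernel s t); μ] := by
  rw [funext (Ybar_of_ne hij), funext (Ybar_of_ne hik)]
  exact UStatistic.covariance_kernel_of_shared hindep hlaw (memLp_betweenKernel hs _ 2) hij hik hjk

theorem tendstoInDistribution_sqrt_mul_FARhat_sub
    (hW : HasLaw W (gaussianReal 0 (4 * cov[Ybar s t X 0 1, Ybar s t X 0 2; P]).toNNReal) P')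
    (hs : Measurable (Function.uncurry s)) (hs_symm : ∀ x y, s x y = s y x)
    (hindep : iIndepFun (fun i ω k => X i k ω) P)
    (hlaw : ∀ i, HasLaw (fun ω k => X i k ω) μ P) :
    TendstoInDistribution
      (fun (G : ℕ) ω => √(G : ℝ) * (FARhat s t X G ω - P[Ybar s t X 0 1]))
      atTop W (fun _ => P) P' := by
  have : IsProbabilityMeasure μ := (hlaw 0).isProbabilityMeasure_iff.1 inferInstance
  have hkernel := memLp_betweenKernel (t := t) hs (μ.prod μ) 2
  have hmean : P[Ybar s t X 0 1] =
      ∫ x, UStatistic.hajekProj μ (betweenKernel s t) x ∂μ := by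
    simp only [Ybar_of_ne zero_ne_one]
    exact UStatistic.integral_kernel hindep hlaw hkernel zero_ne_one
  rw [covariance_Ybar_eq_variance_hajekProj hs hindep hlaw zero_ne_one two_ne_zero.symm
    (by decide)] at hW
  simpa only [FARhat_eq_uStatistic, hmean] using
    UStatistic.tendstoInDistribution_sqrt_mul_uStatistic_sub hW hindep hlaw hkernel
      (betweenKernel_symm hs_symm)

end FaceVerification

open FaceVerification in
theorem proposition1_general
    {Ω : Type*} [MeasurableSpace Ω] (P : Measure Ω) [IsProbabilityMeasure P]
    (d M : ℕ) (hM : 2 ≤ M)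
    (s : EuclideanSpace ℝ (Fin d) → EuclideanSpace ℝ (Fin d) → ℝ)
    (hs_meas : Measurable (Function.uncurry s)) (hs_symm : ∀ x y, s x y = s y x) (t : ℝ)
    (X : ℕ → Fin M → Ω → EuclideanSpace ℝ (Fin d))
    (hX_indep : iIndepFun (fun (i : ℕ) (ω : Ω) (k : Fin M) => X i k ω) P)
    (hX_ident : ∀ i : ℕ, IdentDistrib (fun (ω : Ω) (k : Fin M) => X i k ω)
      (fun (ω : Ω) (k : Fin M) => X 0 k ω) P P)
    (FRR FAR : ℝ)
    (hFRR : ∀ (i : ℕ) (k l : Fin M), k ≠ l → P.real {ω | Y s t X i k i l ω = 1} = FRR)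
    (hFAR : ∀ (i j : ℕ) (k l : Fin M), i ≠ j → P.real {ω | Y s t X i k j l ω = 1} = FAR) :
    (∃ v : ℝ≥0, (v : ℝ) = variance (Ybar s t X 0 0) P ∧
      TendstoInDistribution (fun (G : ℕ) (ω : Ω) => √(G : ℝ) * (FRRhat s t X G ω - FRR))
        atTop (id : ℝ → ℝ) (fun _ => P) (gaussianReal 0 v)) ∧
    (∃ v : ℝ≥0, (v : ℝ) = 4 * covariance (Ybar s t X 0 1) (Ybar s t X 0 2) P ∧
      TendstoInDistribution (fun (G : ℕ) (ω : Ω) => √(G : ℝ) * (FARhat s t X G ω - FAR))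
        atTop (id : ℝ → ℝ) (fun _ => P) (gaussianReal 0 v)) := by
  have hX_aemeas (i : ℕ) (k : Fin M) : AEMeasurable (X i k) P :=
    aemeasurable_pi_iff.1 (hX_ident i).aemeasurable_fst k
  have hX_hasLaw (i : ℕ) : HasLaw (fun ω k => X i k ω) (P.map fun ω k => X 0 k ω) P :=
    ⟨(hX_ident i).aemeasurable_fst, (hX_ident i).map_eq⟩
  have hmeanFRR := integral_Ybar_self hM hs_meas hX_aemeas 0 (hFRR 0)
  have hmeanFAR := integral_Ybar_of_ne (by lia) hs_meas hX_aemeas zero_ne_one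
    fun k l => hFAR 0 1 k l zero_ne_one
  have hcov : 0 ≤ 4 * cov[Ybar s t X 0 1, Ybar s t X 0 2; P] := by
    have := (hX_hasLaw 0).isProbabilityMeasure_iff.1 inferInstance
    rw [covariance_Ybar_eq_variance_hajekProj hs_meas hX_indep hX_hasLaw zero_ne_one
      two_ne_zero.symm (by decide)]
    exact mul_nonneg zero_le_four (variance_nonneg _ _)
  refine ⟨⟨_, Real.coe_toNNReal _ (variance_nonneg _ _), ?_⟩,
    ⟨_, Real.coe_toNNReal _ hcov, ?_⟩⟩
  · simpa only [hmeanFRR] using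
      tendstoInDistribution_sqrt_mul_FRRhat_sub (s := s) (t := t) .id hs_meas hX_indep hX_hasLaw
  · simpa only [hmeanFAR] using
      tendstoInDistribution_sqrt_mul_FARhat_sub (s := s) (t := t) .id hs_meas hs_symm hX_indep
        hX_hasLaw

open FaceVerification in
theorem proposition1
    {Ω : Type*} [MeasurableSpace Ω] (P : Measure Ω) [IsProbabilityMeasure P]
    (d M : ℕ) (hM : 2 ≤ M)
    -- a measurable, symmetric similarity function and a threshold
    (s : EuclideanSpace ℝ (Fin d) → EuclideanSpace ℝ (Fin d) → ℝ)
    (hs_meas : Measurable (Function.uncurry s)) (hs_symm : ∀ x y, s x y = s y x) (t : ℝ)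
    -- `X i k` is the embedding of instance `k` of identity `i`; all have the common law `Q`
    (Q : Measure (EuclideanSpace ℝ (Fin d)))
    (X : ℕ → Fin M → Ω → EuclideanSpace ℝ (Fin d))
    (hX_meas : ∀ i k, Measurable (X i k))
    (hX_law : ∀ i k, P.map (X i k) = Q)
    -- the families of embeddings of the different identities are independent copies of each other
    (hX_indep : iIndepFun (fun (i : ℕ) (ω : Ω) (k : Fin M) => X i k ω) P)
    (hX_ident : ∀ i : ℕ, IdentDistrib (fun (ω : Ω) (k : Fin M) => X i k ω)
      (fun (ω : Ω) (k : Fin M) => X 0 k ω) P P)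
    -- `FRR` and `FAR` are the parameters of the Bernoulli variables `Y`
    (FRR FAR : ℝ)
    (hFRR : ∀ (i : ℕ) (k l : Fin M), k ≠ l → P.real {ω | Y s t X i k i l ω = 1} = FRR)
    (hFAR : ∀ (i j : ℕ) (k l : Fin M), i ≠ j → P.real {ω | Y s t X i k j l ω = 1} = FAR)
    (cFRR cFAR : ℝ) (hcFRR : 0 < cFRR) (hcFAR : 0 < cFAR)
    (hvarFRR : Tendsto (fun G : ℕ => variance (fun ω => √(G : ℝ) * FRRhat s t X G ω) P)
      atTop (nhds cFRR))
    (hvarFAR : Tendsto (fun G : ℕ => variance (fun ω => √(G : ℝ) * FARhat s t X G ω) P)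
      atTop (nhds cFAR)) :
    (∃ v : ℝ≥0, (v : ℝ) = variance (Ybar s t X 0 0) P ∧
      TendstoInDistribution (fun (G : ℕ) (ω : Ω) => √(G : ℝ) * (FRRhat s t X G ω - FRR))
        atTop (id : ℝ → ℝ) (fun _ => P) (gaussianReal 0 v)) ∧
    (∃ v : ℝ≥0, (v : ℝ) = 4 * covariance (Ybar s t X 0 1) (Ybar s t X 0 2) P ∧
      TendstoInDistribution (fun (G : ℕ) (ω : Ω) => √(G : ℝ) * (FARhat s t X G ω - FAR))
        atTop (id : ℝ → ℝ) (fun _ => P) (gaussianReal 0 v)) :=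
  proposition1_general P d M hM s hs_meas hs_symm t X hX_indep hX_ident FRR FAR hFRR hFAR
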